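/- Let $\kappa$ be a regular uncountable cardinal and let $\lambda$ be a singular cardinal such that $\operatorname{cf}(\lambda)\ge\kappa$ and $\tau^{\operatorname{cf}(\lambda)}<\lambda$ for every cardinal $\tau<\lambda$. Let $P_\kappa(\lambda)=\{a\subseteq\lambda:|a|<\kappa\}$. An \emph{ideal} on $P_\kappa(\lambda)$ is a collection $J$ of subsets of $P_\kappa(\lambda)$ such that (i) $J$ contains every noncofinal set, that is, every $A\subseteq P_\kappa(\lambda)$ for which some $b\in P_\kappa(\lambda)$ is included in no member of $A$; (ii) $P_\kappa(\lambda)\notin J$; (iii) $J$ is closed under subsets; (iv) $J$ is closed under unions of fewer than $\kappa$ of its members. Put $J^+=\{A\subseteq P_\kappa(\lambda):A\notin J\}$, $J^*=\{A\subseteq P_\kappa(\lambda):P_\kappa(\lambda)\setminus A\in J\}$ and, for $A\in J^+$, $J|A=\{B\subseteq P_\kappa(\lambda):B\cap A\in J\}$. For a cardinal $\mu\le\lambda$, $J$ is \emph{$\mu$-normal} if for every $A\in J^+$ and every $f:A\to\mu$ with $f(a)\in a$ for all $a\in A$ there is $B\in J^+$ with $B\subseteq A$ on which $f$ is constant. Let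 $NS^{\mu}_{\kappa,\lambda}$ be the smallest $\mu$-normal ideal on $P_\kappa(\lambda)$, and let $NS_{\kappa,\lambda}$ be the nonstationary ideal, that is, the collection of all subsets of $P_\kappa(\lambda)$ disjoint from some closed unbounded $C\subseteq P_\kappa(\lambda)$ (every $b\in P_\kappa(\lambda)$ is included in a member of $C$, and the union of every nonempty $\subseteq$-chain of fewer than $\kappa$ members of $C$ is in $C$). Let $\mathcal M_J$ be the collection of all $Q\subseteq J^+$ such that $A\cap B\in J$ for any distinct $A,B\in Q$ and such that for every $C\in J^+$ there is $A\in Q$ with $A\cap C\in J^+$. The ideal $J$ is \emph{precipitous} if for every $A\in J^+$ and every sequence $\langle Q_n:n<\omega\rangle$ of members of $\mathcal M_{J|A}$ such that every member of $Q_{n+1}$ is included in a member of $Q_n$, for all $n<\omega$, there are $X_n\in Q_n$ $(n<\omega)$ with $X_0\supseteq X_1\supseteq\cdots$ and $\bigcap_{n<\omega}X_n\ne\emptyset$. The ideal $J$ is \emph{nowhere precipitous} if $J|A$ is not precipitous for every $A\in J^+$. Then there exists $B\in NS_{\kappa,\lambda}^*$ such that $NS^{\operatorname{cf}(\lambda)}_{\kappa,\lambda}|B$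 is (an ideal on $P_\kappa(\lambda)$ that is) nowhere precipitous. -/

import Mathlib

universe u

open Cardinal

namespace PKappa

/-- `P_κ(λ)`: the subsets of `λ` of cardinality less than `κ`, the cardinal `λ` being realised as
the canonical well-ordered set of order type `λ.ord` (the ordinals below `λ`). -/
abbrev Pk (κ lam : Cardinal.{u}) : Type u :=
  {a : Set lam.ord.ToType // #a < κ}

/-- The ordinal represented by an element of `λ`. -/
noncomputable def toOrd {lam : Cardinal.{u}} (x : lam.ord.ToType) : Ordinal.{u} :=
  (Ordinal.ToType.mk.symm x : Ordinal.{u})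

/-- `I_{κ,λ}`: the noncofinal subsets of `P_κ(λ)`. -/
def noncofinal (κ lam : Cardinal.{u}) : Set (Set (Pk κ lam)) :=
  {A | ∃ b : Pk κ lam, ∀ a ∈ A, ¬ b.1 ⊆ a.1}

/-- Ideals on `P_κ(λ)`: proper, `κ`-complete, and containing every noncofinal set. -/
structure IsIdeal {κ lam : Cardinal.{u}} (J : Set (Set (Pk κ lam))) : Prop where
  noncofinal_subset : noncofinal κ lam ⊆ J
  univ_notMem : Set.univ ∉ J
  mem_of_subset : ∀ A ∈ J, ∀ B ⊆ A, B ∈ J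
  sUnion_mem : ∀ X ⊆ J, #X < κ → ⋃₀ X ∈ J

/-- `J^+`. -/
def positive {κ lam : Cardinal.{u}} (J : Set (Set (Pk κ lam))) : Set (Set (Pk κ lam)) :=
  {A | A ∉ J}

/-- `J^*`, the filter dual to `J`. -/
def dualFilter {κ lam : Cardinal.{u}} (J : Set (Set (Pk κ lam))) : Set (Set (Pk κ lam)) :=
  {A | Aᶜ ∈ J}

/-- The restriction `J | A`. -/
def restrict {κ lam : Cardinal.{u}} (J : Set (Set (Pk κ lam))) (A : Set (Pk κ lam)) :
    Set (Set (Pk κ lam)) :=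
  {B | B ∩ A ∈ J}

/-- `μ`-normality: every regressive function with values in `μ` on a `J`-positive set is constant
on a `J`-positive subset. -/
def IsNormal {κ lam : Cardinal.{u}} (μ : Cardinal.{u}) (J : Set (Set (Pk κ lam))) : Prop :=
  ∀ A ∈ positive J, ∀ f : Pk κ lam → lam.ord.ToType,
    (∀ a ∈ A, f a ∈ a.1 ∧ toOrd (f a) < μ.ord) →
      ∃ B ∈ positive J, B ⊆ A ∧ ∃ c, ∀ a ∈ B, f a = c

/-- `NS^μ_{κ,λ}`: the smallest `μ`-normal ideal on `P_κ(λ)`, as the intersection of all of them. -/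
def NSmu (κ lam μ : Cardinal.{u}) : Set (Set (Pk κ lam)) :=
  ⋂₀ {J | IsIdeal J ∧ IsNormal μ J}

/-- Closed unbounded subsets of `P_κ(λ)`: cofinal, and closed under unions of nonempty
`⊆`-chains of fewer than `κ` members (such unions have cardinality `< κ` for `κ` regular). -/
structure IsClub {κ lam : Cardinal.{u}} (C : Set (Pk κ lam)) : Prop where
  unbounded : ∀ b : Pk κ lam, ∃ a ∈ C, b.1 ⊆ a.1
  closed : ∀ D ⊆ C, D.Nonempty → IsChain (fun a b : Pk κ lam => a.1 ⊆ b.1) D → #D < κ →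
    ∀ c : Pk κ lam, c.1 = ⋃ a ∈ D, a.1 → c ∈ C

/-- `NS_{κ,λ}`: the nonstationary subsets of `P_κ(λ)`, those disjoint from some club. -/
def NS (κ lam : Cardinal.{u}) : Set (Set (Pk κ lam)) :=
  {A | ∃ C : Set (Pk κ lam), IsClub C ∧ A ∩ C = ∅}

/-- `M_J`: the maximal `J`-almost disjoint families of `J`-positive sets. -/
def maxAntichains {κ lam : Cardinal.{u}} (J : Set (Set (Pk κ lam))) :
    Set (Set (Set (Pk κ lam))) :=
  {Q | Q ⊆ positive J ∧ (∀ A ∈ Q, ∀ B ∈ Q, A ≠ B → A ∩ B ∈ J) ∧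
    ∀ C ∈ positive J, ∃ A ∈ Q, A ∩ C ∈ positive J}

/-- Precipitousness, through refining sequences of maximal almost disjoint families. -/
def Precipitous {κ lam : Cardinal.{u}} (J : Set (Set (Pk κ lam))) : Prop :=
  ∀ A ∈ positive J, ∀ Q : ℕ → Set (Set (Pk κ lam)),
    (∀ n, Q n ∈ maxAntichains (restrict J A)) →
    (∀ n, ∀ B' ∈ Q (n + 1), ∃ B ∈ Q n, B' ⊆ B) →
      ∃ f : ℕ → Set (Pk κ lam), (∀ n, f n ∈ Q n) ∧ (∀ n, f (n + 1) ⊆ f n) ∧ (⋂ n, f n).Nonempty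

/-- `J` is an ideal on `P_κ(λ)` no restriction of which to a positive set is precipitous. -/
def NowherePrecipitous {κ lam : Cardinal.{u}} (J : Set (Set (Pk κ lam))) : Prop :=
  IsIdeal J ∧ ∀ A ∈ positive J, ¬ Precipitous (restrict J A)

end PKappa

/-! Let `M` be cf(λ), embedded by `ι` as an initial segment of λ, and let `r : λ → M` have initial
segments of size above 2^cf(λ) and below λ. Take `B` to be the club of those `a` whose trace on `M`
strictly dominates `r` on `a`. Restricted to `B`, the ideal is dual to the filter generated by
closure under binary functions from `M` into P_κ(λ) (`restrict_NSmu_dominating`).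

Split `B` into fibers by the least strict upper bound `d` of the trace of `a` on `M`. In fiber `d`,
closure under `f` depends only on the trace of `f` below `d`. Let Θ_d be the number of such traces.
The key count is that every positive set meets some fiber in at least Θ_d points
(`exists_mk_range_trace_le_mk_fiber`). Here τ^cf(λ) < λ is essential: it lets elements of λ code
families of truncated traces.

Given a positive set and an ordinal function `F` whose segments are small in each fiber, enumerate
the traces at `d` in type Θ_d. Injectively choose, for each trace with enough closed points, one
such point whose `F`-value exceeds the index of the trace. The chosen points form a positive set,
and the index is a smaller function, again with small segments (`exists_smallSegments_lt`).
Iterating along maximal antichains would turn a point common to a decreasing branch into an infinite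
descent of ordinals (`not_precipitous_of_descent`). -/

namespace PKappa

/-! ### The restricted ideal as a closure ideal -/

section Ideal

variable {κ lam : Cardinal.{u}} {M : Type u}

/-- The elements of `P_κ(λ)` closed under a binary set-valued function on the set indexed by `ι`. -/
def closedUnder (ι : M → lam.ord.ToType) (f : M → M → Pk κ lam) : Set (Pk κ lam) :=
  {a | ∀ i j, ι i ∈ a.1 → ι j ∈ a.1 → (f i j).1 ⊆ a.1}

/-- The elements `a` of `P_κ(λ)` whose nonempty trace on `M` strictly dominates `r` on `a`. -/
def dominating (κ : Cardinal.{u}) [LT M] (ι : M → lam.ord.ToType) (r : lam.ord.ToType → M) :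
    Set (Pk κ lam) :=
  {a | (∃ i, ι i ∈ a.1) ∧ ∀ x ∈ a.1, ∃ i, ι i ∈ a.1 ∧ r x < i}

/-- The ideal dual to the filter generated by the sets `dominating ∩ closedUnder f`. -/
def closureIdeal (κ : Cardinal.{u}) [LT M] (ι : M → lam.ord.ToType) (r : lam.ord.ToType → M) :
    Set (Set (Pk κ lam)) :=
  {W | ∃ f : M → M → Pk κ lam, ∀ a ∈ W, a ∈ dominating κ ι r → a ∉ closedUnder ι f}

/-- The union of fewer than `κ` members of `P_κ(λ)`. -/
def iUnionPk (hκ : κ.IsRegular) {I : Type u} (hI : #I < κ) (g : I → Pk κ lam) : Pk κ lam :=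
  ⟨⋃ i, (g i).1, (card_iUnion_lt_iff_forall_of_isRegular hκ hI).2 fun i => (g i).2⟩

theorem subset_iUnionPk (hκ : κ.IsRegular) {I : Type u} (hI : #I < κ) (g : I → Pk κ lam) (i : I) :
    (g i).1 ⊆ (iUnionPk hκ hI g).1 :=
  Set.subset_iUnion (fun i => (g i).1) i

/-- The union of two members of `P_κ(λ)`. -/
def unionPk (hκ : κ.IsRegular) (a b : Pk κ lam) : Pk κ lam :=
  ⟨a.1 ∪ b.1, (mk_union_le _ _).trans_lt (add_lt_of_lt hκ.aleph0_le a.2 b.2)⟩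

/-- A singleton as a member of `P_κ(λ)`. -/
def singletonPk (hκ : κ.IsRegular) (x : lam.ord.ToType) : Pk κ lam :=
  ⟨{x}, by simpa using one_lt_aleph0.trans_le hκ.aleph0_le⟩

/-- Every member of `P_κ(λ)` extends to one closed under a given binary set-valued function. -/
theorem exists_superset_closed (hκ : κ.IsRegular) (hunc : ℵ₀ < κ)
    (F : lam.ord.ToType → lam.ord.ToType → Pk κ lam) (b : Pk κ lam) :
    ∃ a : Pk κ lam, b.1 ⊆ a.1 ∧ ∀ x ∈ a.1, ∀ y ∈ a.1, (F x y).1 ⊆ a.1 := by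
  let step : Pk κ lam → Pk κ lam := fun c =>
    unionPk hκ c (iUnionPk hκ (I := c.1 × c.1)
      (by rw [mk_prod, lift_id]; exact mul_lt_of_lt hκ.aleph0_le c.2 c.2)
      fun p => F p.1 p.2)
  let s : ℕ → Pk κ lam := fun n => step^[n] b
  have hs : ∀ n, s (n + 1) = step (s n) := fun n => Function.iterate_succ_apply' step n b
  have hmono : Monotone fun n => (s n).1 := monotone_nat_of_le_succ fun n => by
    simp only [hs]; exact Set.subset_union_left
  have hN : #(ULift.{u} ℕ) < κ := by simpa using hunc
  refine ⟨iUnionPk hκ hN fun n => s n.down,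
    subset_iUnionPk hκ hN (fun n => s n.down) ⟨0⟩, ?_⟩
  intro x hx y hy
  obtain ⟨⟨m⟩, hm⟩ := Set.mem_iUnion.1 hx
  obtain ⟨⟨n⟩, hn⟩ := Set.mem_iUnion.1 hy
  have hx' := hmono (le_max_left m n) hm
  have hy' := hmono (le_max_right m n) hn
  refine Set.Subset.trans ?_ (subset_iUnionPk hκ hN (fun n => s n.down) ⟨max m n + 1⟩)
  simp only [hs]
  refine Set.Subset.trans ?_ Set.subset_union_right
  intro z hz
  exact Set.mem_iUnion.2 ⟨⟨⟨x, hx'⟩, ⟨y, hy'⟩⟩, hz⟩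

theorem inter_closedUnder_notMem [LT M] {ι : M → lam.ord.ToType}
    {r : lam.ord.ToType → M} (hκ : κ.IsRegular) {W : Set (Pk κ lam)}
    (hW : W ∉ closureIdeal κ ι r) (f : M → M → Pk κ lam) :
    W ∩ closedUnder ι f ∉ closureIdeal κ ι r := by
  rintro ⟨g, hg⟩
  refine hW ⟨fun i j => unionPk hκ (f i j) (g i j), fun a ha hd hc => ?_⟩
  exact hg a ⟨ha, fun i j hi hj => Set.subset_union_left.trans (hc i j hi hj)⟩ hd
    fun i j hi hj => Set.subset_union_right.trans (hc i j hi hj)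

variable [Nonempty M] {ι : M → lam.ord.ToType} {r : lam.ord.ToType → M}

/-- Two uses of normality fix the pair `(i, j)` witnessing non-closure on a positive set. No member
of that set includes `f i j`, so it is noncofinal, a contradiction. -/
theorem compl_closedUnder_mem (hι : Function.Injective ι) {μ : Cardinal.{u}}
    (hμ : ∀ i, toOrd (ι i) < μ.ord) {J : Set (Set (Pk κ lam))} (hJ : IsIdeal J)
    (hn : IsNormal μ J) (f : M → M → Pk κ lam) : (closedUnder ι f)ᶜ ∈ J := by
  by_contra hpos
  have hwit : ∀ a ∈ (closedUnder ι f)ᶜ, ∃ q : M × M, ι q.1 ∈ a.1 ∧ ι q.2 ∈ a.1 ∧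
      ¬ (f q.1 q.2).1 ⊆ a.1 := by
    intro a ha
    simp only [closedUnder, Set.mem_compl_iff, Set.mem_ofPred_eq, not_forall] at ha
    obtain ⟨i, j, hi, hj, h⟩ := ha
    exact ⟨(i, j), hi, hj, h⟩
  choose! q hq using hwit
  obtain ⟨B, hB, hBA, c, hc⟩ := hn _ hpos (fun a => ι (q a).1)
    fun a ha => ⟨(hq a ha).1, hμ _⟩
  obtain ⟨B', hB', hBB', c', hc'⟩ := hn _ hB (fun a => ι (q a).2)
    fun a ha => ⟨(hq a (hBA ha)).2.1, hμ _⟩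
  obtain rfl | ⟨b, hb⟩ := B'.eq_empty_or_nonempty
  · exact hB' (hJ.noncofinal_subset
      ⟨f (Classical.arbitrary M) (Classical.arbitrary M), fun a ha => ha.elim⟩)
  · refine hB' (hJ.noncofinal_subset ⟨f (q b).1 (q b).2, fun a ha => ?_⟩)
    have h1 : (q a).1 = (q b).1 := hι ((hc a (hBB' ha)).trans (hc b (hBB' hb)).symm)
    have h2 : (q a).2 = (q b).2 := hι ((hc' a ha).trans (hc' b hb).symm)
    rw [← h1, ← h2]
    exact (hq a (hBA (hBB' ha))).2.2

variable [LinearOrder M] [NoMaxOrder M]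

theorem exists_mem_dominating_closedUnder (hκ : κ.IsRegular) (hunc : ℵ₀ < κ)
    (hι : Function.Injective ι) (f : M → M → Pk κ lam) (b : Pk κ lam) :
    ∃ a ∈ dominating κ ι r, a ∈ closedUnder ι f ∧ b.1 ⊆ a.1 := by
  have i₀ : M := Classical.arbitrary M
  let F : lam.ord.ToType → lam.ord.ToType → Pk κ lam := fun x y =>
    unionPk hκ (f (Function.invFun ι x) (Function.invFun ι y))
      (singletonPk hκ (ι (exists_gt (r x)).choose))
  obtain ⟨a, hba, ha⟩ := exists_superset_closed hκ hunc F (unionPk hκ b (singletonPk hκ (ι i₀)))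
  refine ⟨a, ⟨⟨i₀, hba (Or.inr rfl)⟩, fun x hx => ?_⟩, fun i j hi hj => ?_,
    fun x hx => hba (Or.inl hx)⟩
  · exact ⟨(exists_gt (r x)).choose, ha x hx x hx (Or.inr rfl), (exists_gt (r x)).choose_spec⟩
  · have := ha _ hi _ hj
    intro z hz
    refine this (Or.inl ?_)
    simpa [Function.leftInverse_invFun hι i, Function.leftInverse_invFun hι j] using hz

theorem isClub_dominating (hκ : κ.IsRegular) (hunc : ℵ₀ < κ) (hι : Function.Injective ι) :
    IsClub (dominating κ ι r) where
  unbounded b := by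
    obtain ⟨a, ha, -, hba⟩ := exists_mem_dominating_closedUnder (r := r) hκ hunc hι (fun _ _ => b) b
    exact ⟨a, ha, hba⟩
  closed := by
    rintro D hD ⟨a, ha⟩ - - c hc
    have hsub : ∀ b ∈ D, b.1 ⊆ c.1 := fun b hb =>
      hc ▸ Set.subset_biUnion_of_mem (u := fun b : Pk κ lam => b.1) hb
    refine ⟨(hD ha).1.imp fun i hi => hsub a ha hi, fun x hx => ?_⟩
    rw [hc] at hx
    obtain ⟨b, hb, hxb⟩ := Set.mem_iUnion₂.1 hx
    exact ((hD hb).2 x hxb).imp fun i hi => ⟨hsub b hb hi.1, hi.2⟩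

theorem dominating_mem_dualFilter (hκ : κ.IsRegular) (hunc : ℵ₀ < κ) (hι : Function.Injective ι) :
    dominating κ ι r ∈ dualFilter (NS κ lam) :=
  ⟨_, isClub_dominating hκ hunc hι, Set.compl_inter_self _⟩

theorem isIdeal_closureIdeal (hκ : κ.IsRegular) (hunc : ℵ₀ < κ) (hι : Function.Injective ι) :
    IsIdeal (closureIdeal κ ι r) where
  noncofinal_subset := by
    rintro A ⟨b, hb⟩
    refine ⟨fun _ _ => b, fun a ha hd hc => hb a ha ?_⟩
    obtain ⟨i, hi⟩ := hd.1
    exact hc i i hi hi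
  univ_notMem := by
    rintro ⟨f, hf⟩
    obtain ⟨a, ha, hc, -⟩ := exists_mem_dominating_closedUnder (r := r) hκ hunc hι f
      (f (Classical.arbitrary M) (Classical.arbitrary M))
    exact hf a trivial ha hc
  mem_of_subset := by
    rintro A ⟨f, hf⟩ B hB
    exact ⟨f, fun a ha => hf a (hB ha)⟩
  sUnion_mem := by
    intro X hX hcard
    have : Nonempty (Pk κ lam) := ⟨⟨∅, by simpa using hκ.pos⟩⟩
    have hX' : ∀ W ∈ X, ∃ f : M → M → Pk κ lam, ∀ a ∈ W, a ∈ dominating κ ι r →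
        a ∉ closedUnder ι f := fun W hW => hX hW
    choose! f hf using hX'
    refine ⟨fun i j => iUnionPk hκ hcard fun W : X => f W i j, ?_⟩
    rintro a ⟨W, hW, ha⟩ hd hc
    exact hf W hW a ha hd fun i j hi hj =>
      (subset_iUnionPk hκ hcard (fun W : X => f W i j) ⟨W, hW⟩).trans (hc i j hi hj)

/-- If normality fails, each value `c` has its own function `f c`. A pairing `e` of `M` folds them
into one binary function: closure supplies `e (c, i)` from `c` and `i`, and `f c i j` is then read
off at `(e (c, i), j)`. -/
theorem isNormal_closureIdeal (hκ : κ.IsRegular) {μ : Cardinal.{u}}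
    (hrange : ∀ x, toOrd x < μ.ord → x ∈ Set.range ι) :
    IsNormal μ (closureIdeal κ ι r) := by
  intro A hA p hp
  by_contra hcon
  push Not at hcon
  have key : ∀ c : M, ∃ f : M → M → Pk κ lam, ∀ a ∈ A, p a = ι c → a ∈ dominating κ ι r →
      a ∉ closedUnder ι f := by
    intro c
    by_contra hc
    obtain ⟨a, ha, hne⟩ := hcon {a | a ∈ A ∧ p a = ι c}
      (fun ⟨f, hf⟩ => hc ⟨f, fun a ha hpa => hf a ⟨ha, hpa⟩⟩) (fun a ha => ha.1) (ι c)
    exact hne ha.2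
  choose f hf using key
  have : Infinite M := NoMaxOrder.infinite
  obtain ⟨e⟩ : Nonempty (M × M ≃ M) := by
    rw [← Cardinal.eq, mk_prod, lift_id, mul_eq_self (aleph0_le_mk M)]
  refine hA ⟨fun i j => unionPk hκ (singletonPk hκ (ι (e (i, j))))
    (f (e.symm i).1 (e.symm i).2 j), fun a ha hd hc => ?_⟩
  obtain ⟨c, hca⟩ := hrange _ (hp a ha).2
  have hcmem : ι c ∈ a.1 := hca ▸ (hp a ha).1
  refine hf c a ha hca.symm hd fun i j hi hj z hz => ?_
  have hci : ι (e (c, i)) ∈ a.1 := hc c i hcmem hi (Or.inl rfl)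
  exact hc _ j hci hj (Or.inr (by simpa using hz))

/-- The closure ideal is itself a μ-normal ideal, hence one of those intersected; conversely every
μ-normal ideal contains the complements of the closure sets. -/
theorem restrict_NSmu_dominating (hκ : κ.IsRegular) (hunc : ℵ₀ < κ) (hι : Function.Injective ι)
    {μ : Cardinal.{u}} (hμ : ∀ x, toOrd x < μ.ord ↔ x ∈ Set.range ι) :
    restrict (NSmu κ lam μ) (dominating κ ι r) = closureIdeal κ ι r := by
  ext W
  constructor
  · intro hW
    obtain ⟨f, hf⟩ := hW (closureIdeal κ ι r)
      ⟨isIdeal_closureIdeal hκ hunc hι, isNormal_closureIdeal hκ fun x => (hμ x).1⟩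
    exact ⟨f, fun a ha hd => hf a ⟨ha, hd⟩ hd⟩
  · rintro ⟨f, hf⟩ J ⟨hJ, hn⟩
    exact hJ.mem_of_subset _ (compl_closedUnder_mem hι (fun i => (hμ _).2 ⟨i, rfl⟩) hJ hn f) _
      fun a ha => hf a ha.1 ha.2

end Ideal
/-- A family of at most `Θ` sets, each of size at least `Θ`, has an injective selector. -/
theorem exists_injective_selector {I β : Type u} {Θ : Cardinal.{u}} (hI : #I ≤ Θ)
    (S : I → Set β) (hS : ∀ i, Θ ≤ #(S i)) :
    ∃ a : I → β, Function.Injective a ∧ ∀ i, a i ∈ S i := by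
  obtain ⟨_, _, hr⟩ := exists_ord_eq_type_lt I
  have hex : ∀ i (g : ∀ j, j < i → β), ∃ b ∈ S i, ∀ j h, g j h ≠ b := by
    intro i g
    have h1 : #(Set.range fun j : Set.Iio i => g j.1 j.2) < Θ :=
      mk_range_le.trans_lt ((mk_Iio_lt i hr).trans_le hI)
    have h2 : ¬ S i ⊆ Set.range fun j : Set.Iio i => g j.1 j.2 := fun h =>
      ((hS i).trans (mk_le_mk_of_subset h)).not_gt h1
    obtain ⟨b, hb, hnb⟩ := Set.not_subset.1 h2
    exact ⟨b, hb, fun j h e => hnb ⟨⟨j, h⟩, e⟩⟩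
  choose pick hpick hne using hex
  let a : I → β := wellFounded_lt.fix pick
  have ha : ∀ i, a i = pick i fun j _ => a j := fun i => wellFounded_lt.fix_eq pick i
  have hlt : ∀ i j, j < i → a j ≠ a i := by
    intro i j h
    rw [ha i]
    exact hne i (fun j _ => a j) j h
  refine ⟨a, fun i j hij => ?_, fun i => ?_⟩
  · rcases lt_trichotomy i j with h | h | h
    · exact (hlt j i h hij).elim
    · exact h
    · exact (hlt i j h hij.symm).elim
  · rw [ha i]; exact hpick _ _

/-! ### Fibers, traces and the counting lemma -/

section Trace

variable {κ lam : Cardinal.{u}} {M : Type u} [LinearOrder M]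

/-- The intersection of a member of `P_κ(λ)` with a set. -/
def interPk (S : Set lam.ord.ToType) (a : Pk κ lam) : Pk κ lam :=
  ⟨a.1 ∩ S, (mk_le_mk_of_subset Set.inter_subset_left).trans_lt a.2⟩

/-- The part of a function `f` that decides which `a` living below `d` are closed under `f`. -/
def trace (r : lam.ord.ToType → M) (d : M) (f : M → M → Pk κ lam) : M → M → Pk κ lam × Prop :=
  fun i j => (interPk {x | r x < d} (f i j), (f i j).1 ⊆ {x | r x < d})

/-- The traces all of whose values live at or below `k`. -/
def BoundedTrace (κ : Cardinal.{u}) (r : lam.ord.ToType → M) (k : M) : Type u :=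
  {v : M → M → Pk κ lam × Prop // ∀ i j, (v i j).1.1 ⊆ {x | r x ≤ k}}

/-- Truncation of a trace at `k`. -/
def truncate (r : lam.ord.ToType → M) (k : M) (v : M → M → Pk κ lam × Prop) : BoundedTrace κ r k :=
  ⟨fun i j => (interPk {x | r x ≤ k} (v i j).1, (v i j).2), fun _ _ => Set.inter_subset_right⟩

/-- The members of `P_κ(λ)` closed under every function with trace `v`. -/
def closedUnderTrace (ι : M → lam.ord.ToType) (v : M → M → Pk κ lam × Prop) : Set (Pk κ lam) :=
  {a | ∀ i j, ι i ∈ a.1 → ι j ∈ a.1 → (v i j).2 ∧ (v i j).1.1 ⊆ a.1}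

/-- The members `a` of `P_κ(λ)` in `dominating` such that `d` is the least strict upper bound of
the trace of `a` on `M`. -/
def fiber (κ : Cardinal.{u}) (ι : M → lam.ord.ToType) (r : lam.ord.ToType → M) (d : M) :
    Set (Pk κ lam) :=
  {a | a ∈ dominating κ ι r ∧ (∀ i, ι i ∈ a.1 → i < d) ∧ ∀ k < d, ∃ i, ι i ∈ a.1 ∧ k ≤ i}

variable {ι : M → lam.ord.ToType} {r : lam.ord.ToType → M}

theorem fiber_unique {a : Pk κ lam} {d d' : M} (h : a ∈ fiber κ ι r d) (h' : a ∈ fiber κ ι r d') :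
    d = d' := by
  rcases lt_trichotomy d d' with hlt | rfl | hlt
  · obtain ⟨i, hi, hle⟩ := h'.2.2 d hlt
    exact absurd (h.2.1 i hi) hle.not_gt
  · rfl
  · obtain ⟨i, hi, hle⟩ := h.2.2 d' hlt
    exact absurd (h'.2.1 i hi) hle.not_gt

theorem exists_mem_fiber [WellFoundedLT M]
    (hι : Function.Injective ι) (hbdd : ∀ s : Set M, #s < κ → ∃ d, ∀ i ∈ s, i < d)
    {a : Pk κ lam} (ha : a ∈ dominating κ ι r) : ∃ d, a ∈ fiber κ ι r d := by
  have hcard : #(ι ⁻¹' a.1) < κ := (mk_preimage_of_injective ι a.1 hι).trans_lt a.2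
  have hne : {d | ∀ i ∈ ι ⁻¹' a.1, i < d}.Nonempty := hbdd _ hcard
  refine ⟨wellFounded_lt.min _ hne, ha, fun i hi => wellFounded_lt.min_mem _ hne i hi, ?_⟩
  intro k hk
  by_contra hcon
  push Not at hcon
  exact wellFounded_lt.not_lt_min {d | ∀ i ∈ ι ⁻¹' a.1, i < d} (x := k) (fun i hi => hcon i hi) hk

theorem subset_below_of_mem_fiber {a : Pk κ lam} {d : M} (h : a ∈ fiber κ ι r d) :
    a.1 ⊆ {x | r x < d} := by
  intro x hx
  obtain ⟨i, hi, hlt⟩ := h.1.2 x hx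
  exact hlt.trans (h.2.1 i hi)

/-- Points of fiber `d` lie below `d`, so `f i j` can be included in one only if it too lies below
`d`; the propositional coordinate of the trace records this. -/
theorem mem_closedUnder_iff_trace {a : Pk κ lam} {d : M} (h : a ∈ fiber κ ι r d)
    (f : M → M → Pk κ lam) : a ∈ closedUnder ι f ↔ a ∈ closedUnderTrace ι (trace r d f) := by
  refine forall₂_congr fun i j => forall₂_congr fun _ _ => ⟨fun hs => ?_, fun hs => ?_⟩
  · exact ⟨hs.trans (subset_below_of_mem_fiber h), Set.inter_subset_left.trans hs⟩
  · intro x hx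
    exact hs.2 ⟨hx, hs.1 hx⟩

/-- A trace at `d` is determined by its truncations to the elements of a cofinal subset of `d`. -/
theorem trace_eq_of_truncate_eq {a : Pk κ lam} {d : M} (h : a ∈ fiber κ ι r d)
    {f g : M → M → Pk κ lam}
    (hfg : ∀ k, ι k ∈ a.1 → truncate r k (trace r d f) = truncate r k (trace r d g)) :
    trace r d f = trace r d g := by
  have hval : ∀ k, ι k ∈ a.1 → ∀ i j,
      (interPk {x | r x ≤ k} (trace r d f i j).1, (trace r d f i j).2) =
        (interPk {x | r x ≤ k} (trace r d g i j).1, (trace r d g i j).2) := fun k hk i j =>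
    congrFun (congrFun (congrArg Subtype.val (hfg k hk)) i) j
  have hsub : ∀ {f g : M → M → Pk κ lam}, (∀ k, ι k ∈ a.1 → ∀ i j,
      (interPk {x | r x ≤ k} (trace r d f i j).1, (trace r d f i j).2) =
        (interPk {x | r x ≤ k} (trace r d g i j).1, (trace r d g i j).2)) →
      ∀ i j, (trace r d f i j).1.1 ⊆ (trace r d g i j).1.1 := by
    intro f g H i j x hx
    obtain ⟨k, hk, hle⟩ := h.2.2 (r x) hx.2
    have h1 := congrArg (fun p => p.1.1) (H k hk i j)
    have h2 : x ∈ (interPk {x | r x ≤ k} (trace r d f i j).1).1 := ⟨hx, hle⟩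
    rw [h1] at h2
    exact h2.1
  obtain ⟨k, hk⟩ := h.1.1
  funext i j
  refine Prod.ext (Subtype.ext ?_) ?_
  · exact (hsub hval i j).antisymm (hsub (fun k hk i j => (hval k hk i j).symm) i j)
  · exact (Prod.ext_iff.1 (hval k hk i j)).2

/-- Constant functions with distinct singleton values below `d` have distinct traces. This is what
makes Θ_d exceed 2^cf(λ). -/
theorem mk_le_mk_range_trace (hκ : κ.IsRegular) [Nonempty M] {k d : M} (hkd : k < d) :
    #{x | r x ≤ k} ≤ #(Set.range (trace (κ := κ) r d)) := by
  let g : {x | r x ≤ k} → Set.range (trace (κ := κ) r d) := fun x =>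
    ⟨_, ⟨fun _ _ => singletonPk hκ x.1, rfl⟩⟩
  refine mk_le_of_injective (f := g) fun x y hxy => ?_
  have i : M := Classical.arbitrary M
  have h1 : ({x.1} ∩ {x | r x < d} : Set lam.ord.ToType) = {y.1} ∩ {x | r x < d} :=
    congrArg (fun v => (v.1 i i).1.1) hxy
  have h2 : x.1 ∈ ({x.1} ∩ {x | r x < d} : Set lam.ord.ToType) := ⟨rfl, x.2.trans_lt hkd⟩
  rw [h1] at h2
  exact Subtype.ext h2.1

/-- Every positive set has a fiber at least as large as the number of traces. -/
theorem exists_mk_range_trace_le_mk_fiber [WellFoundedLT M] [Nonempty M] [Infinite M]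
    (hκ : κ.IsRegular) (hκM : κ ≤ #M) (hι : Function.Injective ι)
    (hbdd : ∀ s : Set M, #s < κ → ∃ d, ∀ i ∈ s, i < d)
    (hbig : ∀ k, 2 ^ #M < #{x | r x ≤ k})
    {code : (Σ k, M → BoundedTrace κ r k) → lam.ord.ToType} (hcode : Function.Injective code)
    {W : Set (Pk κ lam)} (hW : W ∉ closureIdeal κ ι r) :
    ∃ d, #(Set.range (trace (κ := κ) r d)) ≤ #(W ∩ fiber κ ι r d : Set (Pk κ lam)) := by
  by_contra hcon
  push Not at hcon
  -- For each `d` some trace is coded in no point of `W` over `d`. The family `x` is constrained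
  -- only at coordinate `d`, so that one family can later serve all `d` at once.
  have hexists : ∀ d, ∃ f : M → M → Pk κ lam, ∀ a ∈ W ∩ fiber κ ι r d,
      ∀ x : ∀ k, M → BoundedTrace κ r k, (∀ k, x k d = truncate r k (trace r d f)) →
        ∃ k, ι k ∈ a.1 ∧ code ⟨k, x k⟩ ∉ a.1 := by
    intro d
    by_contra hno
    push Not at hno
    choose a ha x hx hxa using hno
    -- Otherwise a trace is recovered from a point `a` and the subset of `a` formed by its codes,
    -- giving Θ_d ≤ |W ∩ fiber| · 2^cf(λ) < Θ_d.
    let P := Σ a : (W ∩ fiber κ ι r d : Set (Pk κ lam)), Set a.1.1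
    let sec : Set.range (trace (κ := κ) r d) → (M → M → Pk κ lam) := fun v => v.2.choose
    have hsec : ∀ v, trace r d (sec v) = v.1 := fun v => v.2.choose_spec
    let g : Set.range (trace (κ := κ) r d) → P := fun v =>
      ⟨⟨a (sec v), ha (sec v)⟩, {z | ∃ k, ι k ∈ (a (sec v)).1 ∧ z.1 = code ⟨k, x (sec v) k⟩}⟩
    have hg : Function.Injective g := by
      intro v w hvw
      have h1 : a (sec v) = a (sec w) := congrArg (fun p : P => p.1.1) hvw
      have h2 : Subtype.val '' (g v).2 = Subtype.val '' (g w).2 :=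
        congrArg (fun p : P => Subtype.val '' p.2) hvw
      rw [Subtype.ext_iff, ← hsec v, ← hsec w]
      refine trace_eq_of_truncate_eq (ha (sec v)).2 fun k hk => ?_
      have h3 : code ⟨k, x (sec v) k⟩ ∈ Subtype.val '' (g v).2 :=
        ⟨⟨_, hxa (sec v) k hk⟩, ⟨k, hk, rfl⟩, rfl⟩
      rw [h2] at h3
      obtain ⟨z, ⟨k', -, hz⟩, hz'⟩ := h3
      have h4 := hcode (hz'.symm.trans hz)
      obtain rfl : k = k' := congrArg Sigma.fst h4
      rw [← hx, ← hx, eq_of_heq (Sigma.mk.inj h4).2]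
    have hle : #(Set.range (trace (κ := κ) r d)) ≤ #P := mk_le_of_injective hg
    have hP : #P ≤ #(W ∩ fiber κ ι r d : Set (Pk κ lam)) * 2 ^ #M := by
      rw [mk_sigma, ← sum_const']
      refine sum_le_sum _ _ fun b => ?_
      rw [mk_set]
      exact power_le_power_left two_ne_zero (b.1.2.le.trans hκM)
    obtain ⟨k, hk⟩ : ∃ k, k < d := by
      let f₀ : M → M → Pk κ lam := fun _ _ => ⟨∅, by simpa using hκ.pos⟩
      obtain ⟨i, hi⟩ := (ha f₀).2.1.1
      exact ⟨i, (ha f₀).2.2.1 i hi⟩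
    refine (hle.trans hP).not_gt (mul_lt_of_lt ?_ (hcon d) ?_)
    · exact ((aleph0_le_mk M).trans (cantor _).le).trans
        ((hbig k).le.trans (mk_le_mk_range_trace hκ hk))
    · exact (hbig k).trans_le (mk_le_mk_range_trace hκ hk)
  choose f hf using hexists
  let x : ∀ k, M → BoundedTrace κ r k := fun k d => truncate r k (trace r d (f d))
  -- A point of `W` closed under `k ↦ code ⟨k, x k⟩` contains all codes for its own `d`, contrary to
  -- the choice of `f d`.
  refine hW ⟨fun k _ => singletonPk hκ (code ⟨k, x k⟩), fun a ha hd hc => ?_⟩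
  obtain ⟨d, had⟩ := exists_mem_fiber hι hbdd hd
  obtain ⟨k, hk, hka⟩ := hf d a ⟨ha, had⟩ x fun k => rfl
  exact hka (hc k k hk hk rfl)

end Trace
-- Descent of ordinal functions on positive sets
section Descent

variable {κ lam : Cardinal.{u}} {M : Type u} [LinearOrder M]
  {ι : M → lam.ord.ToType} {r : lam.ord.ToType → M}

/-- On each fiber of `W`, the initial segments of `F` below the number of traces are smaller than
that number. -/
def SmallSegments (ι : M → lam.ord.ToType) (r : lam.ord.ToType → M) (W : Set (Pk κ lam))
    (F : Pk κ lam → Ordinal.{u}) : Prop :=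
  ∀ d, ∀ α < (#(Set.range (trace (κ := κ) r d))).ord,
    #{a | a ∈ W ∩ fiber κ ι r d ∧ F a ≤ α} < #(Set.range (trace (κ := κ) r d))

theorem SmallSegments.mono {W W' : Set (Pk κ lam)} {F : Pk κ lam → Ordinal.{u}} (hW : W' ⊆ W)
    (h : SmallSegments ι r W F) : SmallSegments ι r W' F := fun d α hα =>
  (mk_le_mk_of_subset (t := {a | a ∈ W ∩ fiber κ ι r d ∧ F a ≤ α})
    fun _ ha => ⟨⟨hW ha.1.1, ha.1.2⟩, ha.2⟩).trans_lt (h d α hα)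

theorem mk_range_trace_pos (hκ : κ.IsRegular) (d : M) :
    0 < #(Set.range (trace (κ := κ) r d)) :=
  pos_iff_ne_zero.2 (mk_ne_zero_iff.2 ⟨⟨_, ⟨fun _ _ => ⟨∅, by simpa using hκ.pos⟩, rfl⟩⟩⟩)

/-- A constant at least every Θ_d makes all the relevant segments empty. -/
theorem exists_smallSegments_univ [Nonempty M] (hκ : κ.IsRegular) :
    ∃ F, SmallSegments (κ := κ) ι r Set.univ F := by
  refine ⟨fun a => ⨆ d, (#(Set.range (trace (κ := κ) r d))).ord, fun d α hα => ?_⟩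
  have : {a | a ∈ Set.univ ∩ fiber κ ι r d ∧
      ⨆ d, (#(Set.range (trace (κ := κ) r d))).ord ≤ α} = ∅ := by
    refine Set.eq_empty_of_forall_notMem fun a ha => ?_
    exact (ha.2.trans_lt hα).not_ge (Ordinal.le_iSup _ d)
  rw [this, mk_eq_zero]
  exact mk_range_trace_pos hκ d

theorem aleph0_le_mk_range_trace [Infinite M] (hκ : κ.IsRegular)
    (hbig : ∀ k, 2 ^ #M < #{x | r x ≤ k}) {a : Pk κ lam} {d : M} (ha : a ∈ fiber κ ι r d) :
    ℵ₀ ≤ #(Set.range (trace (κ := κ) r d)) := by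
  obtain ⟨i, hi⟩ := ha.1.1
  exact ((aleph0_le_mk M).trans (cantor _).le).trans
    ((hbig i).le.trans (mk_le_mk_range_trace hκ (ha.2.1 i hi)))

/-- A positive set with an ordinal-valued function with small segments contains a positive set
with a smaller such function. -/
theorem exists_smallSegments_lt [WellFoundedLT M] [Infinite M]
    (hκ : κ.IsRegular) (hκM : κ ≤ #M) (hι : Function.Injective ι)
    (hbdd : ∀ s : Set M, #s < κ → ∃ d, ∀ i ∈ s, i < d)
    (hbig : ∀ k, 2 ^ #M < #{x | r x ≤ k})
    {code : (Σ k, M → BoundedTrace κ r k) → lam.ord.ToType} (hcode : Function.Injective code)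
    {W : Set (Pk κ lam)} (hW : W ∉ closureIdeal κ ι r) {F : Pk κ lam → Ordinal.{u}}
    (hF : SmallSegments ι r W F) :
    ∃ W' ∉ closureIdeal κ ι r, W' ⊆ W ∧ ∃ F', SmallSegments ι r W' F' ∧ ∀ a ∈ W', F' a < F a := by
  let Θ : M → Cardinal.{u} := fun d => #(Set.range (trace (κ := κ) r d))
  have e : ∀ d, (Θ d).ord.ToType ≃ Set.range (trace (κ := κ) r d) := fun d =>
    (Cardinal.eq.1 (mk_ord_toType (Θ d))).some
  let rank : ∀ d, Set.range (trace (κ := κ) r d) → Ordinal.{u} := fun d v => toOrd ((e d).symm v)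
  have hrank : ∀ d v, rank d v < (Θ d).ord := fun d v =>
    (Ordinal.ToType.mk.symm ((e d).symm v)).2
  -- Only traces with at least Θ_d closed points are served; removing the small segment of `F` up to
  -- the index still leaves Θ_d candidates.
  let I : M → Type u := fun d => {v : Set.range (trace (κ := κ) r d) //
    Θ d ≤ #((W ∩ fiber κ ι r d) ∩ closedUnderTrace ι v.1 : Set (Pk κ lam))}
  let S : ∀ d, I d → Set (Pk κ lam) := fun d v =>
    {a | a ∈ (W ∩ fiber κ ι r d) ∩ closedUnderTrace ι v.1.1 ∧ rank d v.1 < F a}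
  have hS : ∀ d v, Θ d ≤ #(S d v) := by
    intro d v
    by_contra! hlt
    have hsub : (W ∩ fiber κ ι r d) ∩ closedUnderTrace ι v.1.1 ⊆
        S d v ∪ {a | a ∈ W ∩ fiber κ ι r d ∧ F a ≤ rank d v.1} := by
      intro a ha
      rcases lt_or_ge (rank d v.1) (F a) with h | h
      · exact Or.inl ⟨ha, h⟩
      · exact Or.inr ⟨ha.1, h⟩
    have hne : Nonempty ((W ∩ fiber κ ι r d) ∩ closedUnderTrace ι v.1.1 : Set (Pk κ lam)) :=
      mk_ne_zero_iff.1 ((mk_range_trace_pos hκ d).trans_le v.2).ne'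
    obtain ⟨a, ha⟩ := hne
    refine (v.2.trans ((mk_le_mk_of_subset hsub).trans (mk_union_le _ _))).not_gt ?_
    exact add_lt_of_lt (aleph0_le_mk_range_trace hκ hbig ha.1.2) hlt (hF d _ (hrank d _))
  have hsel : ∀ d, ∃ A : I d → Pk κ lam, Function.Injective A ∧ ∀ v, A v ∈ S d v := fun d =>
    exists_injective_selector (mk_subtype_le _) (S d) (hS d)
  choose A hAinj hAmem using hsel
  let p : (Σ d, I d) → Pk κ lam := fun q => A q.1 q.2
  have hp : Function.Injective p := by
    rintro ⟨d, v⟩ ⟨d', v'⟩ h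
    have h' : A d v = A d' v' := h
    obtain rfl : d = d' := fiber_unique (hAmem d v).1.1.2 (h' ▸ (hAmem d' v').1.1.2)
    rw [hAinj d h']
  let F' : Pk κ lam → Ordinal.{u} := Function.extend p (fun q => rank q.1 q.2.1) 0
  have hF' : ∀ d v, F' (A d v) = rank d v.1 := fun d v => hp.extend_apply _ _ ⟨d, v⟩
  refine ⟨Set.range p, ?_, ?_, F', ?_, ?_⟩
  · rintro ⟨f, hf⟩
    -- Applied to the points of `W` closed under `f`, the count shows that the trace of `f` at some
    -- `d` is served, and its selected point is closed under `f`.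
    obtain ⟨d, hd⟩ := exists_mk_range_trace_le_mk_fiber hκ hκM hι hbdd hbig hcode
      (inter_closedUnder_notMem hκ hW f)
    have hv : Θ d ≤ #((W ∩ fiber κ ι r d) ∩ closedUnderTrace ι (trace r d f) :
        Set (Pk κ lam)) :=
      hd.trans (mk_le_mk_of_subset fun a ha =>
        ⟨⟨ha.1.1, ha.2⟩, (mem_closedUnder_iff_trace ha.2 f).1 ha.1.2⟩)
    let v : I d := ⟨⟨_, ⟨f, rfl⟩⟩, hv⟩
    have hm := (hAmem d v).1
    exact hf (A d v) ⟨⟨d, v⟩, rfl⟩ hm.1.2.1 ((mem_closedUnder_iff_trace hm.1.2 f).2 hm.2)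
  · rintro _ ⟨⟨d, v⟩, rfl⟩
    exact (hAmem d v).1.1.1
  · intro d α hα
    let T := {a | a ∈ Set.range p ∩ fiber κ ι r d ∧ F' a ≤ α}
    change #T < Θ d
    obtain hT | ⟨a, ha⟩ := T.eq_empty_or_nonempty
    · rw [hT, mk_eq_zero]
      exact mk_range_trace_pos hκ d
    let t : (Θ d).ord.ToType := Ordinal.ToType.mk ⟨α, hα⟩
    have hsub : T ⊆ A d '' {v | (e d).symm v.1 ∈ Set.Iic t} := by
      rintro _ ⟨⟨⟨⟨d', v⟩, rfl⟩, hfib⟩, hle⟩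
      obtain rfl : d' = d := fiber_unique (hAmem d' v).1.1.2 hfib
      refine ⟨v, ?_, rfl⟩
      have hle' : rank d' v.1 ≤ α := (hF' d' v) ▸ hle
      change (e d').symm v.1 ≤ Ordinal.ToType.mk ⟨α, hα⟩
      rw [← OrderIso.symm_apply_le]
      exact hle'
    have hinj : #{v : I d | (e d).symm v.1 ∈ Set.Iic t} ≤ #(Set.Iic t) :=
      mk_preimage_of_injective (fun v : I d => (e d).symm v.1) (Set.Iic t)
        ((e d).symm.injective.comp Subtype.val_injective)
    refine (((mk_le_mk_of_subset hsub).trans mk_image_le).trans hinj).trans_lt ?_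
    have := mk_Iic_lt t (by simp) (by
      rw [mk_ord_toType]; exact aleph0_le_mk_range_trace hκ hbig ha.1.2)
    rwa [mk_ord_toType] at this
  · rintro _ ⟨⟨d, v⟩, rfl⟩
    exact (hF' d v).trans_lt (hAmem d v).2

end Descent

/-! ### Precipitousness and descending functions -/

section Precipitous

variable {κ lam : Cardinal.{u}} {J : Set (Set (Pk κ lam))}

/-- A dense family of positive sets contains a maximal almost disjoint family. -/
theorem exists_maxAntichains_subset (hJ : ∀ A ∈ J, ∀ B ⊆ A, B ∈ J) (D : Set (Set (Pk κ lam)))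
    (hD : D ⊆ positive J) (hdense : ∀ C ∈ positive J, ∃ X ∈ D, X ⊆ C) :
    ∃ Q ⊆ D, Q ∈ maxAntichains J := by
  obtain ⟨Q, hQ⟩ := zorn_subset
    {Q : Set (Set (Pk κ lam)) | Q ⊆ D ∧ Q.Pairwise fun A B => A ∩ B ∈ J} (by
      intro c hc hchain
      refine ⟨⋃₀ c, ⟨Set.sUnion_subset fun s hs => (hc hs).1, ?_⟩,
        fun s hs => Set.subset_sUnion_of_mem hs⟩
      exact (Set.pairwise_sUnion hchain.directedOn).2 fun s hs => (hc hs).2)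
  refine ⟨Q, hQ.prop.1, fun A hA => hD (hQ.prop.1 hA), fun A hA B hB h => hQ.prop.2 hA hB h, ?_⟩
  intro C hC
  obtain ⟨X, hXD, hXC⟩ := hdense C hC
  by_contra! hcon
  have hX : ∀ A ∈ Q, A ∩ X ∈ J := fun A hA =>
    hJ (A ∩ C) (not_not.1 (hcon A hA)) _ (Set.inter_subset_inter_right A hXC)
  have hins : insert X Q ∈
      {Q : Set (Set (Pk κ lam)) | Q ⊆ D ∧ Q.Pairwise fun A B => A ∩ B ∈ J} := by
    refine ⟨Set.insert_subset hXD hQ.prop.1, hQ.prop.2.insert fun A hA _ => ?_⟩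
    exact ⟨Set.inter_comm A X ▸ hX A hA, hX A hA⟩
  have hXQ : X ∈ Q := hQ.le_of_ge hins (Set.subset_insert X Q) (Set.mem_insert X Q)
  exact hD hXD (Set.inter_self X ▸ hX X hXQ)

/-- An ideal is not precipitous if ordinal-valued functions on its positive sets can always be
made smaller on a positive subset. -/
theorem not_precipitous_of_descent (hJ : ∀ A ∈ J, ∀ B ⊆ A, B ∈ J) (huniv : Set.univ ∉ J)
    (Φ : Set (Pk κ lam) → (Pk κ lam → Ordinal.{u}) → Prop)
    (hΦ : ∀ W W' F, W' ⊆ W → Φ W F → Φ W' F) (hstart : ∃ F, Φ Set.univ F)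
    (hstep : ∀ W ∈ positive J, ∀ F, Φ W F →
      ∃ W' ∈ positive J, W' ⊆ W ∧ ∃ F', Φ W' F' ∧ ∀ a ∈ W', F' a < F a) :
    ¬ Precipitous J := by
  let State := {s : Set (Set (Pk κ lam)) × (Set (Pk κ lam) → Pk κ lam → Ordinal.{u}) //
    s.1 ∈ maxAntichains J ∧ ∀ X ∈ s.1, Φ X (s.2 X)}
  have hnext : ∀ s : State, ∃ s' : State, ∀ X ∈ s'.1.1, ∃ Y ∈ s.1.1, X ⊆ Y ∧
      ∀ a ∈ X, s'.1.2 X a < s.1.2 Y a := by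
    rintro ⟨⟨Q, G⟩, hQ, hG⟩
    let D := {X | X ∈ positive J ∧ ∃ F, Φ X F ∧ ∃ Y ∈ Q, X ⊆ Y ∧ ∀ a ∈ X, F a < G Y a}
    obtain ⟨Q', hsubD, hQ'⟩ := exists_maxAntichains_subset hJ D (fun X hX => hX.1) (by
      intro C hC
      obtain ⟨Y, hY, hYC⟩ := hQ.2.2 C hC
      obtain ⟨X, hX, hXY, F, hF, hlt⟩ := hstep _ hYC (G Y)
        (hΦ Y _ _ Set.inter_subset_left (hG Y hY))
      exact ⟨X, ⟨hX, F, hF, Y, hY, hXY.trans Set.inter_subset_left, hlt⟩,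
        hXY.trans Set.inter_subset_right⟩)
    have hchoice : ∀ X ∈ Q', ∃ F, Φ X F ∧ ∃ Y ∈ Q, X ⊆ Y ∧ ∀ a ∈ X, F a < G Y a :=
      fun X hX => (hsubD hX).2
    choose! G' hG' hlt using hchoice
    exact ⟨⟨(Q', G'), hQ', hG'⟩, hlt⟩
  choose next hnext using hnext
  obtain ⟨F₀, hF₀⟩ := hstart
  let s₀ : State := ⟨({Set.univ}, fun _ => F₀), ⟨by simpa [positive] using huniv, by simp_all,
    fun C hC => ⟨Set.univ, rfl, by simpa using hC⟩⟩, by simpa using hF₀⟩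
  let s : ℕ → State := fun n => next^[n] s₀
  have hs : ∀ n, s (n + 1) = next (s n) := fun n => Function.iterate_succ_apply' next n s₀
  have hrestrict : restrict J Set.univ = J := by
    ext B
    simp [restrict]
  intro hprec
  obtain ⟨f, hfQ, hfsub, a, ha⟩ := hprec Set.univ huniv (fun n => (s n).1.1)
    (fun n => hrestrict.symm ▸ (s n).2.1) (fun n X hX => by
      rw [hs] at hX
      obtain ⟨Y, hY, hXY, -⟩ := hnext (s n) X hX
      exact ⟨Y, hY, hXY⟩)
  refine not_strictAnti_of_wellFoundedLT (fun n => (s n).1.2 (f n) a)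
    (strictAnti_nat_of_succ_lt fun n => ?_)
  have hX := hfQ (n + 1)
  simp only [hs] at hX ⊢
  obtain ⟨Y, hY, hXY, hlt⟩ := hnext (s n) _ hX
  -- Distinct members of an antichain meet in `J`, but both `f n` and `Y` include the positive set
  -- `f (n + 1)`.
  obtain rfl : f n = Y := by
    by_contra hne
    exact (next (s n)).2.1.1 hX
      (hJ _ ((s n).2.1.2.1 _ (hfQ n) _ hY hne) _ (Set.subset_inter (hfsub n) hXY))
  exact hlt a (Set.mem_iInter.1 ha (n + 1))

end Precipitous

/-! ### Nowhere precipitousness and the size of the code -/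

section Main

variable {κ lam : Cardinal.{u}} {M : Type u} [LinearOrder M]
  {ι : M → lam.ord.ToType} {r : lam.ord.ToType → M}

theorem nowherePrecipitous_closureIdeal [WellFoundedLT M] [NoMaxOrder M] [Nonempty M]
    (hκ : κ.IsRegular) (hunc : ℵ₀ < κ) (hκM : κ ≤ #M) (hι : Function.Injective ι)
    (hbdd : ∀ s : Set M, #s < κ → ∃ d, ∀ i ∈ s, i < d)
    (hbig : ∀ k, 2 ^ #M < #{x | r x ≤ k})
    {code : (Σ k, M → BoundedTrace κ r k) → lam.ord.ToType} (hcode : Function.Injective code) :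
    NowherePrecipitous (closureIdeal κ ι r) := by
  have : Infinite M := NoMaxOrder.infinite
  have hJ := isIdeal_closureIdeal (r := r) hκ hunc hι
  refine ⟨hJ, fun A hA => ?_⟩
  refine not_precipitous_of_descent
    (fun B hB C hC => hJ.mem_of_subset _ hB _ (Set.inter_subset_inter_left A hC))
    (fun h => hA (by simpa [restrict] using h)) (SmallSegments ι r)
    (fun W W' F h hW => hW.mono h) (exists_smallSegments_univ hκ) fun W hW F hF => ?_
  obtain ⟨W', hW', hsub, F', hF', hlt⟩ := exists_smallSegments_lt hκ hκM hι hbdd hbig hcode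
    (W := W ∩ A) hW (hF.mono Set.inter_subset_left)
  refine ⟨W', fun h => hW' ?_, hsub.trans Set.inter_subset_left, F', hF', hlt⟩
  have : W' ∩ A = W' := Set.inter_eq_left.2 (hsub.trans Set.inter_subset_right)
  exact this ▸ h

/-- Each entry is a bit and a subset of the segment of size at most `#M`; the repeated exponents
`#M` collapse into one. -/
theorem mk_boundedTrace_le (hκM : κ ≤ #M) [Infinite M] (k : M) :
    #(BoundedTrace κ r k) ≤ max #{x | r x ≤ k} ℵ₀ ^ #M := by
  set τ := max #{x | r x ≤ k} ℵ₀
  let T := {t : Set lam.ord.ToType // t ⊆ {x | r x ≤ k} ∧ #t ≤ #M}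
  let g : BoundedTrace κ r k → M → M → T × ULift.{u} Prop := fun v i j =>
    (⟨(v.1 i j).1.1, v.2 i j, (v.1 i j).1.2.le.trans hκM⟩, ⟨(v.1 i j).2⟩)
  have hg : Function.Injective g := by
    intro v w h
    refine Subtype.ext (funext fun i => funext fun j => Prod.ext (Subtype.ext ?_) ?_)
    · exact congrArg (fun u => (u i j).1.1) h
    · exact congrArg (fun u => (u i j).2.down) h
  have hT : #T ≤ τ ^ #M := mk_bounded_subset_le _ _
  have hτ : ℵ₀ ≤ τ ^ #M := (le_max_right _ _).trans
    (self_le_power _ (one_le_aleph0.trans (aleph0_le_mk M)))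
  calc #(BoundedTrace κ r k) ≤ #(M → M → T × ULift.{u} Prop) := mk_le_of_injective hg
    _ = ((#T * 2) ^ #M) ^ #M := by simp
    _ ≤ ((τ ^ #M) ^ #M) ^ #M := by
        refine power_le_power_right (power_le_power_right ?_)
        exact (mul_le_mul' hT (natCast_le_aleph0 (n := 2) |>.trans hτ)).trans (mul_eq_self hτ).le
    _ = τ ^ #M := by
        rw [← power_mul, ← power_mul, mul_eq_self (aleph0_le_mk M), mul_eq_self (aleph0_le_mk M)]

theorem exists_code (hκM : κ ≤ #M) [Infinite M] (hM : #M ≤ lam)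
    (hpow : ∀ τ < lam, τ ^ #M < lam) (hsmall : ∀ k, #{x | r x ≤ k} < lam) (hlam : ℵ₀ < lam) :
    ∃ code : (Σ k, M → BoundedTrace κ r k) → lam.ord.ToType, Function.Injective code := by
  suffices h : #(Σ k, M → BoundedTrace κ r k) ≤ #lam.ord.ToType by
    obtain ⟨e⟩ := h
    exact ⟨e, e.injective⟩
  rw [mk_ord_toType, mk_sigma]
  calc sum (fun k => #(M → BoundedTrace κ r k)) ≤ sum fun _ : M => lam := by
        refine sum_le_sum _ _ fun k => ?_
        have h1 : max #{x | r x ≤ k} ℵ₀ < lam := max_lt (hsmall k) hlam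
        calc #(M → BoundedTrace κ r k) = #(BoundedTrace κ r k) ^ #M := by simp
          _ ≤ (max #{x | r x ≤ k} ℵ₀ ^ #M) ^ #M :=
            power_le_power_right (mk_boundedTrace_le hκM k)
          _ = max #{x | r x ≤ k} ℵ₀ ^ #M := by
            rw [← power_mul, mul_eq_self (aleph0_le_mk M)]
          _ ≤ lam := (hpow _ h1).le
    _ = #M * lam := sum_const' _ _
    _ ≤ lam := (mul_le_max_of_aleph0_le_right hlam.le).trans (max_le hM le_rfl)

end Main
-- Cofinality and the choice of `r` and `ι`
/-- A set of size less than the cofinality has a strict upper bound. -/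
theorem exists_forall_lt_of_mk_lt_cof {α : Type u} [LinearOrder α] {s : Set α}
    (hs : #s < Order.cof α) : ∃ d, ∀ i ∈ s, i < d :=
  not_isCofinal_iff.1 fun h => (Order.cof_le h).not_gt hs

/-- For `ν < λ` there is a map from `λ` to `cf λ` whose initial segments have sizes strictly
between `ν` and `λ`. -/
theorem exists_rank_to_cof {lam : Cardinal.{u}} (hlam : lam.IsSingular) {ν : Cardinal.{u}}
    (hν : ν < lam) : ∃ r : lam.ord.ToType → lam.ord.cof.ord.ToType,
      ∀ k, ν < #{x | r x ≤ k} ∧ #{x | r x ≤ k} < lam := by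
  obtain ⟨s, hs, hcard⟩ := Order.exists_cof_eq lam.ord.ToType
  rw [Ordinal.cof_toType] at hcard
  obtain ⟨e⟩ : Nonempty (lam.ord.cof.ord.ToType ≃ s) := by
    rw [← Cardinal.eq, mk_ord_toType, hcard]
  have hsucc : (Order.succ ν).ord < lam.ord := ord_lt_ord.2 (hlam.isSuccLimit.succ_lt hν)
  -- Taking maxima with `y`, which has ν⁺ predecessors, puts all of these in every segment of `r`.
  let y : lam.ord.ToType := Ordinal.ToType.mk ⟨_, hsucc⟩
  have hne : ∀ x, {i | x ≤ max (e i).1 y}.Nonempty := by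
    intro x
    obtain ⟨z, hz, hxz⟩ := hs x
    exact ⟨e.symm ⟨z, hz⟩, by simp [hxz]⟩
  let r : lam.ord.ToType → lam.ord.cof.ord.ToType := fun x => wellFounded_lt.min _ (hne x)
  have hr : ∀ x, x ≤ max (e (r x)).1 y := fun x => wellFounded_lt.min_mem _ (hne x)
  refine ⟨r, fun k => ⟨?_, ?_⟩⟩
  · have hsub : Set.Iio y ⊆ {x | r x ≤ k} := fun x hx =>
      wellFounded_lt.min_le (s := {i | x ≤ max (e i).1 y})
        (show x ≤ max (e k).1 y from le_max_of_le_right (le_of_lt hx))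
    refine (Order.lt_succ ν).trans_le (le_trans ?_ (mk_le_mk_of_subset hsub))
    have h1 : #(Set.Iio y) = (Order.succ ν) := by
      have h2 : Ordinal.typein (α := lam.ord.ToType) (· < ·) y = (Order.succ ν).ord :=
        congrArg Subtype.val (Ordinal.ToType.mk.symm_apply_apply ⟨_, hsucc⟩)
      rw [← card_ord (Order.succ ν), ← h2]
      rfl
    exact h1.ge
  · have hlt : #((fun i => (e i).1) '' Set.Iic k) < Order.cof lam.ord.ToType := by
      rw [Ordinal.cof_toType]
      refine mk_image_le.trans_lt ?_
      have := mk_Iic_lt k (by simp) (by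
        rw [mk_ord_toType, Ordinal.aleph0_le_cof_iff, Ordinal.one_lt_cof_iff]
        exact isSuccLimit_ord hlam.aleph0_le)
      rwa [mk_ord_toType] at this
    obtain ⟨z, hz⟩ := exists_forall_lt_of_mk_lt_cof hlt
    have hsub : {x | r x ≤ k} ⊆ Set.Iic (max z y) := fun x hx =>
      (hr x).trans (max_le_max_right y (hz _ ⟨_, hx, rfl⟩).le)
    refine (mk_le_mk_of_subset hsub).trans_lt ?_
    have := mk_Iic_lt (max z y) (by simp) (by rw [mk_ord_toType]; exact hlam.aleph0_le)
    rwa [mk_ord_toType] at this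

/-- For `μ ≤ λ`, the ordinals below `μ` form an initial segment of the ordinals below `λ`. -/
theorem exists_injective_range_iff {lam μ : Cardinal.{u}} (h : μ ≤ lam) :
    ∃ ι : μ.ord.ToType → lam.ord.ToType, Function.Injective ι ∧
      ∀ x, toOrd x < μ.ord ↔ x ∈ Set.range ι := by
  let ι : μ.ord.ToType → lam.ord.ToType := fun i =>
    Ordinal.ToType.mk ⟨toOrd i, show toOrd i < lam.ord from
      lt_of_lt_of_le (Ordinal.ToType.mk.symm i).2 (ord_le_ord.2 h)⟩
  have hι : ∀ i, toOrd (ι i) = toOrd i := fun i => by simp [ι, toOrd]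
  refine ⟨ι, fun i j hij => ?_, fun x => ⟨fun hx => ?_, ?_⟩⟩
  · have : toOrd i = toOrd j := by rw [← hι, hij, hι]
    exact Ordinal.ToType.mk.symm.injective (Subtype.ext this)
  · exact ⟨Ordinal.ToType.mk ⟨toOrd x, hx⟩, by simp [ι, toOrd]⟩
  · rintro ⟨i, rfl⟩
    rw [hι]
    exact (Ordinal.ToType.mk.symm i).2

end PKappa

theorem proposition3p1 (κ lam : Cardinal.{u}) (hκ : κ.IsRegular) (hκ_unc : Cardinal.aleph0 < κ)
    (hlam : lam.IsSingular) (hcof : κ ≤ lam.ord.cof)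
    (hpow : ∀ τ < lam, τ ^ lam.ord.cof < lam) :
    ∃ B ∈ PKappa.dualFilter (PKappa.NS κ lam),
      PKappa.NowherePrecipitous
        (PKappa.restrict (PKappa.NSmu κ lam lam.ord.cof) B) := by
  have hinf : ℵ₀ ≤ lam.ord.cof := hκ_unc.le.trans hcof
  have hlt : lam.ord.cof < lam := hlam.cof_ord_lt
  have hM : #lam.ord.cof.ord.ToType = lam.ord.cof := mk_ord_toType _
  have : NoMaxOrder lam.ord.cof.ord.ToType := Cardinal.noMaxOrder hinf
  have : Infinite lam.ord.cof.ord.ToType := infinite_iff.2 (hM.symm ▸ hinf)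
  obtain ⟨ι, hι, hrange⟩ := PKappa.exists_injective_range_iff hlt.le
  -- Here ν = 2^cf(λ), which is below λ by the power hypothesis at τ = 2.
  obtain ⟨r, hr⟩ := PKappa.exists_rank_to_cof hlam (hpow 2 (hlam.natCast_lt 2))
  have hpow' : ∀ τ < lam, τ ^ #lam.ord.cof.ord.ToType < lam := by rwa [hM]
  obtain ⟨code, hcode⟩ := PKappa.exists_code (κ := κ) (r := r) (hcof.trans hM.ge)
    (hM.trans_le hlt.le) hpow' (fun k => (hr k).2) (hinf.trans_lt hlt)
  refine ⟨PKappa.dominating κ ι r, PKappa.dominating_mem_dualFilter hκ hκ_unc hι, ?_⟩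
  rw [PKappa.restrict_NSmu_dominating hκ hκ_unc hι hrange]
  refine PKappa.nowherePrecipitous_closureIdeal hκ hκ_unc (hcof.trans hM.ge) hι (fun s hs => ?_)
    (fun k => by rw [hM]; exact (hr k).1) hcode
  refine PKappa.exists_forall_lt_of_mk_lt_cof (hs.trans_le ?_)
  rw [Ordinal.cof_toType, Ordinal.cof_ord_cof]
  exact hcof
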